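/- Let $\mathcal{L}$ be a finite graded lattice with minimum $\hat 0$ and maximum $\hat 1$, and let $\mathcal{I}(\mathcal{L})$ be the set of its join-irreducible elements (elements that are not joins of strictly smaller elements; $\hat 0$, being the empty join, is not join-irreducible). A map $\omega\colon \mathcal{I}(\mathcal{L})\to\mathbb{Z}_{>0}$ induces the labeling $\lambda_\omega(F_1\lessdot F_2)=\min\{\omega(I) : I\in\mathcal{I}(\mathcal{L}),\ F_1\vee I=F_2\}$ of the covering relations of $\mathcal{L}$; the map $\omega$ is called *admissible* if for all $F_1\leqslant F_2$ in $\mathcal{L}$ there is exactly one saturated chain from $F_1$ to $F_2$ whose labels are weakly increasing. A subset $G\subseteq\mathcal{L}\setminus\{\hat 0\}$ is a *building set* if for every $F\in\mathcal{L}$ the join map $\prod_{g\in\max G_{\leqslant F}}[\hat 0,g]\to[\hat 0,F]$, $(H_g)_g\mapsto\bigvee_g H_g$, is an isomorphism of posets, where $G_{\leqslant F}=\{g\in G: g\leqslant F\}$; then $(\mathcal{L},G)$ is called a *graded built lattice*, and it is *irreducible* if $\hat 1\in G$. A subset $S\subseteq G$ is *nested* if $\bigvee A\notin G$ for every antichain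 $A\subseteq S$ with $|A|\geqslant 2$. The *nested set complex* $\mathbf{N}(\mathcal{L},G)$ is the simplicial complex whose faces (including the empty one) are the nested sets that contain no maximal element of $G$. For a finite simplicial complex $\Delta$ of dimension $d-1$ with $f_i$ faces of cardinality $i$ ($0\leqslant i\leqslant d$), the numbers $h_i$ are defined by $\sum_{i=0}^d f_i\,(y-1)^{d-i}=\sum_{i=0}^d h_i\,y^{d-i}$, and the $h$-polynomial of $\Delta$ is $h(\Delta;t)=\sum_{i=0}^d h_i t^i$. **Proposition.** Let $(\mathcal{L},G)$ be an irreducible graded built lattice, and let $\omega\colon\mathcal{I}(\mathcal{L})\to\mathbb{Z}_{>0}$ be an injective admissible map. For a maximal face $S$ of $\mathbf{N}(\mathcal{L},G)$ and $g\in S\cup\{\hat 1\}$ put $\lambda_\omega(g)=\lambda_\omega\bigl(\bigvee S_{<g},\,g\bigr)$, where $S_{<g}=\{s\in S: s<g\}$ (it is known that $g$ covers $\bigvee S_{<g}$). For $g\in S$ let $p(g)=\min\{x\in S\cup\{\hat 1\}: x>g\}$ be the parent of $g$ (it is known that this minimum exists). Call $g\in S$ a *descent* of $S$ if $\lambda_\omega(g)>\lambda_\omega(p(g))$,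 and let $\mathrm{des}(S)$ be the number of descents of $S$. Then $$h(\mathbf{N}(\mathcal{L},G);t)=\sum_{S}t^{\mathrm{des}(S)},$$ where the sum is over all maximal faces $S$ of $\mathbf{N}(\mathcal{L},G)$. -/

import Mathlib

open Polynomial

/-- A finite abstract simplicial complex with vertices in `V`, given by its finite family of faces.
The empty set counts as a face (it contributes `f_0 = 1`, and it is the maximal face of the complex
without vertices). -/
structure FinSimplicialComplex (V : Type*) where
  /-- The faces, the empty face included. -/
  faces : Finset (Finset V)
  empty_mem : ∅ ∈ faces
  down_closed : ∀ ⦃s t : Finset V⦄, s ∈ faces → t ⊆ s → t ∈ faces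

namespace FinSimplicialComplex

variable {V : Type*} (Δ : FinSimplicialComplex V)

/-- The maximal number `d` of vertices of a face, so that the dimension of `Δ` is `d - 1`. -/
def size : ℕ := Δ.faces.sup Finset.card

/-- The number `f_i` of faces of cardinality `i`. -/
def fNum (i : ℕ) : ℕ := (Δ.faces.filter (fun s => s.card = i)).card

/-- The polynomial `∑_{i=0}^d f_i (y - 1)^(d-i)`, which has degree at most `d`. -/
noncomputable def shiftedFPolynomial : ℤ[X] :=
  ∑ i ∈ Finset.range (Δ.size + 1), (Δ.fNum i : ℤ[X]) * (X - 1) ^ (Δ.size - i)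

/-- The entry `h_i` (for `0 ≤ i ≤ d`) of the `h`-vector, determined by
`∑_{i=0}^d f_i (y - 1)^(d-i) = ∑_{i=0}^d h_i y^(d-i)`. -/
noncomputable def hNum (i : ℕ) : ℤ := Δ.shiftedFPolynomial.coeff (Δ.size - i)

/-- The `h`-polynomial `∑_{i=0}^d h_i y^i`. -/
noncomputable def hPolynomial : ℤ[X] :=
  ∑ i ∈ Finset.range (Δ.size + 1), C (Δ.hNum i) * X ^ i

/-- The maximal faces. -/
noncomputable def facets : Finset (Finset V) :=
  by classical exact Δ.faces.filter (fun s => Maximal (· ∈ Δ.faces) s)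

end FinSimplicialComplex

namespace BuiltLattice

/-- A (finite) poset is graded if it has a rank function: a strictly monotone function to `ℕ` which
is `0` on minimal elements and increases by exactly one along each covering relation. -/
def IsGraded (L : Type*) [Preorder L] : Prop := Nonempty (GradeMinOrder ℕ L)

section UnboundedLattice

variable {L : Type*} [Lattice L]

/-- The edge-labeling induced by a map `ω` on the join-irreducible elements:
`λ_ω(a ⋖ b) = min {ω(I) | I join-irreducible, a ∨ I = b}`.
(In a finite lattice the set is nonempty whenever `b` covers `a`.) -/
noncomputable def label (ω : {I : L // SupIrred I} → ℕ+) (a b : L) : ℕ :=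
  sInf {n : ℕ | ∃ I : {I : L // SupIrred I}, a ⊔ (I : L) = b ∧ (ω I : ℕ) = n}

/-- `l` lists, from bottom to top, the elements of a saturated chain from `a` to `b`. -/
def IsSaturatedChain (a b : L) (l : List L) : Prop :=
  l.IsChain (· ⋖ ·) ∧ l.head? = some a ∧ l.getLast? = some b

/-- The sequence of labels of the consecutive covering relations of a saturated chain. -/
noncomputable def chainLabels (ω : {I : L // SupIrred I} → ℕ+) (l : List L) : List ℕ :=
  List.zipWith (label ω) l l.tail

/-- `ω` is admissible if `λ_ω` is an R-labeling: between any two elements `a ≤ b` there is exactly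
one saturated chain whose labels are weakly increasing. -/
def IsAdmissible (ω : {I : L // SupIrred I} → ℕ+) : Prop :=
  ∀ a b : L, a ≤ b →
    ∃! l : List L, IsSaturatedChain a b l ∧ (chainLabels ω l).IsChain (· ≤ ·)

/-- The `G`-factors of `F`: the maximal elements of `G_{≤ F}`. -/
noncomputable def factors (G : Finset L) (F : L) : Finset L := by
  classical exact G.filter (fun g => Maximal (fun x => x ∈ G ∧ x ≤ F) g)

theorem le_of_mem_factors {G : Finset L} {F g : L} (h : g ∈ factors G F) : g ≤ F := by
  classical
  unfold factors at h
  exact (Finset.mem_filter.mp h).2.prop.2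

end UnboundedLattice

variable {L : Type*} [Lattice L] [BoundedOrder L]

/-- The join map `∏_{g ∈ max G_{≤ F}} [0, g] → [0, F]`, `(H_g)_g ↦ ⋁_g H_g`. -/
noncomputable def joinMap (G : Finset L) (F : L)
    (H : (g : {g : L // g ∈ factors G F}) → Set.Iic (g : L)) : Set.Iic F :=
  ⟨Finset.univ.sup (fun g : {g : L // g ∈ factors G F} => (H g : L)),
    Finset.sup_le fun g _ => le_trans (H g).2 (le_of_mem_factors g.2)⟩

/-- `G` is a building set: `G ⊆ L \ {0}` and for every `F` the join map
`∏_{g ∈ max G_{≤ F}} [0, g] → [0, F]` is an isomorphism of posets. -/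
def IsBuildingSet (G : Finset L) : Prop :=
  ⊥ ∉ G ∧ ∀ F : L, ∃ e : ((g : {g : L // g ∈ factors G F}) → Set.Iic (g : L)) ≃o Set.Iic F,
    ⇑e = joinMap G F

/-- `S ⊆ G` is nested if the join of an antichain in `S` with at least two elements is never
in `G`. -/
def IsNested (G S : Finset L) : Prop :=
  S ⊆ G ∧ ∀ A : Finset L, A ⊆ S → IsAntichain (· ≤ ·) (A : Set L) → 2 ≤ A.card → A.sup id ∉ G

/-- The nested set complex `N(L, G)`: its faces are the nested sets which contain no maximal element
of `G`. -/
noncomputable def nestedSetComplex [Fintype L] (G : Finset L) : FinSimplicialComplex L where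
  faces := by
    classical
    exact Finset.univ.filter (fun S => IsNested G S ∧ ∀ g ∈ S, ¬ Maximal (· ∈ G) g)
  empty_mem := by
    classical
    refine Finset.mem_filter.mpr ⟨Finset.mem_univ _, ⟨Finset.empty_subset _, ?_⟩, by simp⟩
    intro A hA _ h2
    rw [Finset.subset_empty.mp hA] at h2
    simp at h2
  down_closed := by
    classical
    intro s t hs hts
    obtain ⟨_, ⟨hsG, hA⟩, hm⟩ := Finset.mem_filter.mp hs
    exact Finset.mem_filter.mpr ⟨Finset.mem_univ _,
      ⟨hts.trans hsG, fun A hAt => hA A (hAt.trans hts)⟩, fun g hg => hm g (hts hg)⟩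

/-- The join `⋁ S_{< g}` of the elements of `S` which are strictly below `g`. -/
noncomputable def lowerJoin (S : Finset L) (g : L) : L := by
  classical exact (S.filter (· < g)).sup id

/-- `λ_ω(g) = λ_ω(⋁ S_{< g}, g)`, the label of `g ∈ S ∪ {1}` with respect to the
maximal nested set `S`. -/
noncomputable def nestedLabel (ω : {I : L // SupIrred I} → ℕ+) (S : Finset L) (g : L) : ℕ :=
  label ω (lowerJoin S g) g

/-- `p` is the parent of `g`, i.e. the minimum of `(S ∪ {1})_{> g}`. -/
def IsParent (S : Finset L) (g p : L) : Prop :=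
  IsLeast {x : L | (x ∈ S ∨ x = ⊤) ∧ g < x} p

/-- `g ∈ S` is a descent of `S` if `λ_ω(g) > λ_ω(p(g))`. -/
def IsDescent (ω : {I : L // SupIrred I} → ℕ+) (S : Finset L) (g : L) : Prop :=
  g ∈ S ∧ ∃ p : L, IsParent S g p ∧ nestedLabel ω S p < nestedLabel ω S g

/-- The descent number `des(S)`. -/
noncomputable def des (ω : {I : L // SupIrred I} → ℕ+) (S : Finset L) : ℕ := by
  classical exact (S.filter (fun g => IsDescent ω S g)).card

/-- The descent `h`-polynomial `∑_S t^{des(S)}`, where `S` runs over the maximal faces of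
`N(L, G)`. -/
noncomputable def descentHPolynomial [Fintype L] (G : Finset L)
    (ω : {I : L // SupIrred I} → ℕ+) : ℤ[X] :=
  ∑ S ∈ (nestedSetComplex G).facets, X ^ des ω S

end BuiltLattice

/-! The descent sets partition the complex: for every face `T` exactly one facet `S` satisfies
`Des(S) ⊆ T ⊆ S`. Since the complex is pure, each interval `[Des(S), S]` contributes `t^des(S)` to
the `h`-polynomial (`hPolynomial_eq_sum_of_partition`).

To find the facet, adjoin `⊤` to `T` and let `C` be the flag of partial joins along a linear
extension. Admissibility, applied between consecutive elements of `C`, gives a unique saturated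
chain through `C` whose labels fall only at elements of `C`. Saturated chains and maximal nested
sets are linked by factors: each cover adds a factor (`exists_isNested_of_saturated`), a linear
extension of a nested set `M` of size `grade ⊤` gives back a saturated chain, and the labels agree
(`IsLinExt.label_partialJoin`).

Existence: the nested set read off from this chain has descents only in `T`, as no element of `C`
separates `g ∉ T` from its parent. Uniqueness: if all descents of `M ⊇ T` lie in `T`, sorting `M` by
position relative to `C`, then by label, is a linear extension. Its chain is the unique one above,
and its factors recover `M`. -/

namespace FinSimplicialComplex

/-! ### The `h`-polynomial of a partitioned complex -/

variable {V : Type*} (Δ : FinSimplicialComplex V)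

theorem mem_facets {S : Finset V} : S ∈ Δ.facets ↔ Maximal (· ∈ Δ.faces) S := by
  classical
  unfold facets
  rw [Finset.mem_filter]
  exact ⟨fun h => h.2, fun h => ⟨h.prop, h⟩⟩

theorem shiftedFPolynomial_eq_sum_faces :
    Δ.shiftedFPolynomial = ∑ T ∈ Δ.faces, (X - 1) ^ (Δ.size - T.card) := by
  classical
  unfold shiftedFPolynomial fNum
  have hmaps : ∀ T ∈ Δ.faces, T.card ∈ Finset.range (Δ.size + 1) := fun T hT =>
    Finset.mem_range.mpr (Nat.lt_succ_of_le (Finset.le_sup (f := Finset.card) hT))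
  rw [← Finset.sum_fiberwise_of_maps_to hmaps]
  refine Finset.sum_congr rfl fun i _ => ?_
  rw [Finset.sum_congr rfl (g := fun _ => (X - 1 : ℤ[X]) ^ (Δ.size - i))]
  · simp
  · intro T hT
    rw [(Finset.mem_filter.mp hT).2]

/-- If the faces of a pure complex are partitioned into the intervals `[R S, S]`, with `S` running
over the facets, then the `h`-polynomial is `∑_S t^|R S|`. -/
theorem hPolynomial_eq_sum_of_partition (hpure : ∀ S ∈ Δ.facets, S.card = Δ.size)
    (R : Finset V → Finset V) (hR : ∀ S ∈ Δ.facets, R S ⊆ S)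
    (hpart : ∀ T ∈ Δ.faces, ∃! S, S ∈ Δ.facets ∧ R S ⊆ T ∧ T ⊆ S) :
    Δ.hPolynomial = ∑ S ∈ Δ.facets, X ^ (R S).card := by
  classical
  have hfaces : Δ.faces = Δ.facets.biUnion fun S => Finset.Icc (R S) S := by
    ext T
    simp only [Finset.mem_biUnion, Finset.mem_Icc]
    constructor
    · intro hT
      obtain ⟨S, ⟨hS, h1, h2⟩, -⟩ := hpart T hT
      exact ⟨S, hS, h1, h2⟩
    · rintro ⟨S, hS, -, h2⟩
      exact Δ.down_closed (Δ.mem_facets.mp hS).prop h2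
  have hdisj : (Δ.facets : Set (Finset V)).PairwiseDisjoint fun S => Finset.Icc (R S) S := by
    intro S hS S' hS' hne
    refine Finset.disjoint_left.mpr fun T hT hT' => hne ?_
    rw [Finset.mem_Icc] at hT hT'
    exact (hpart T (Δ.down_closed (Δ.mem_facets.mp hS).prop hT.2)).unique
      ⟨hS, hT.1, hT.2⟩ ⟨hS', hT'.1, hT'.2⟩
  have hinterval : ∀ S ∈ Δ.facets,
      ∑ T ∈ Finset.Icc (R S) S, (X - 1 : ℤ[X]) ^ (Δ.size - T.card)
        = X ^ (Δ.size - (R S).card) := by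
    intro S hS
    have hRS := hR S hS
    rw [← hpure S hS, ← Finset.card_sdiff_of_subset hRS]
    have key := Finset.sum_pow_mul_eq_add_pow (X - 1 : ℤ[X]) 1 (S \ R S)
    simp only [one_pow, mul_one, sub_add_cancel] at key
    rw [← key]
    -- Complements in `S` turn `[R S, S]` into the powerset of `S \ R S`, where the binomial theorem
    -- `key` applies.
    refine Finset.sum_bij' (fun T _ => S \ T) (fun U _ => S \ U) ?_ ?_ ?_ ?_ ?_
    · intro T hT
      rw [Finset.mem_Icc] at hT
      exact Finset.mem_powerset.mpr (Finset.sdiff_subset_sdiff le_rfl hT.1)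
    · intro U hU
      rw [Finset.mem_powerset] at hU
      rw [Finset.mem_Icc]
      refine ⟨fun x hx => Finset.mem_sdiff.mpr ⟨hRS hx, fun hxU => ?_⟩, Finset.sdiff_subset⟩
      exact (Finset.mem_sdiff.mp (hU hxU)).2 hx
    · intro T hT
      exact Finset.sdiff_sdiff_eq_self (Finset.mem_Icc.mp hT).2
    · intro U hU
      exact Finset.sdiff_sdiff_eq_self ((Finset.mem_powerset.mp hU).trans Finset.sdiff_subset)
    · intro T hT
      rw [Finset.card_sdiff_of_subset (Finset.mem_Icc.mp hT).2]
  have hshift : Δ.shiftedFPolynomial = ∑ S ∈ Δ.facets, X ^ (Δ.size - (R S).card) := by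
    rw [shiftedFPolynomial_eq_sum_faces]
    conv_lhs => rw [hfaces]
    rw [Finset.sum_biUnion hdisj]
    exact Finset.sum_congr rfl hinterval
  have hle : ∀ S ∈ Δ.facets, (R S).card ≤ Δ.size := fun S hS =>
    (Finset.card_le_card (hR S hS)).trans (hpure S hS).le
  ext i
  simp only [hPolynomial, hNum, hshift, finsetSum_coeff, coeff_C_mul, coeff_X_pow, mul_ite,
    mul_one, mul_zero]
  rw [Finset.sum_ite_eq]
  split_ifs with hi
  · rw [Finset.mem_range] at hi
    refine Finset.sum_congr rfl fun S hS => ?_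
    have := hle S hS
    exact if_congr (by omega) rfl rfl
  · rw [Finset.mem_range] at hi
    refine (Finset.sum_eq_zero fun S hS => ?_).symm
    have := hle S hS
    exact if_neg (by omega)

end FinSimplicialComplex

namespace BuiltLattice

/-! ### Factors of a building set -/

section Factors

variable {L : Type*} [Lattice L] {G : Finset L} {F g : L}

theorem mem_factors : g ∈ factors G F ↔ Maximal (fun x => x ∈ G ∧ x ≤ F) g := by
  classical
  unfold factors
  rw [Finset.mem_filter]
  exact ⟨fun h => h.2, fun h => ⟨h.prop.1, h⟩⟩

theorem mem_of_mem_factors (h : g ∈ factors G F) : g ∈ G := (mem_factors.mp h).prop.1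

theorem eq_of_mem_factors_of_le {g' : L} (h : g ∈ factors G F) (hg' : g' ∈ G) (hF : g' ≤ F)
    (hle : g ≤ g') : g' = g :=
  ((mem_factors.mp h).eq_of_le ⟨hg', hF⟩ hle).symm

theorem exists_factor_ge (hg : g ∈ G) (hF : g ≤ F) : ∃ h ∈ factors G F, g ≤ h := by
  classical
  obtain ⟨h, hgh, hh⟩ := (G.filter (· ≤ F)).finite_toSet.exists_le_maximal (a := g)
    (by simp [hg, hF])
  refine ⟨h, mem_factors.mpr ?_, hgh⟩
  simpa using hh

end Factors

section BuildingSet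

variable {L : Type*} [Lattice L] [BoundedOrder L] {G : Finset L}

theorem IsBuildingSet.ne_bot (hG : IsBuildingSet G) {g : L} (hg : g ∈ G) : g ≠ ⊥ :=
  fun h => hG.1 (h ▸ hg)

/-- Cancellation of the other factors. The join map reflects order, so comparing the family `x` at
`h`, `⊥` elsewhere, with the family `k` at `h`, everything elsewhere, can be done at the component
`h`. -/
theorem IsBuildingSet.le_of_le_sup_erase [DecidableEq L] (hG : IsBuildingSet G) {F h k x : L}
    (hh : h ∈ factors G F) (hk : k ≤ h) (hx : x ≤ h)
    (hle : x ≤ k ⊔ ((factors G F).erase h).sup id) : x ≤ k := by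
  obtain ⟨e, he⟩ := hG.2 F
  let h' : {g : L // g ∈ factors G F} := ⟨h, hh⟩
  let H : (g : {g : L // g ∈ factors G F}) → Set.Iic (g : L) :=
    fun g => if hg : g = h' then ⟨x, by rw [hg]; exact hx⟩ else ⟨⊥, bot_le⟩
  let K : (g : {g : L // g ∈ factors G F}) → Set.Iic (g : L) :=
    fun g => if hg : g = h' then ⟨k, by rw [hg]; exact hk⟩ else ⟨g, le_rfl⟩
  have hHK : e H ≤ e K := by
    rw [he]
    change Finset.univ.sup (fun g => (H g : L)) ≤ Finset.univ.sup (fun g => (K g : L))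
    have h1 : Finset.univ.sup (fun g => (H g : L)) ≤ x := by
      refine Finset.sup_le fun g _ => ?_
      by_cases hg : g = h' <;> simp [H, hg]
    refine (h1.trans hle).trans (sup_le ?_ (Finset.sup_le fun g hg => ?_))
    · have : k = (K h' : L) := by simp [K]
      rw [this]
      exact Finset.le_sup (f := fun g => (K g : L)) (Finset.mem_univ h')
    · rw [Finset.mem_erase] at hg
      have hne : (⟨g, hg.2⟩ : {g : L // g ∈ factors G F}) ≠ h' :=
        fun heq => hg.1 (congrArg Subtype.val heq)
      have : id g = (K ⟨g, hg.2⟩ : L) := by simp [K, hne]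
      rw [this]
      exact Finset.le_sup (f := fun g => (K g : L)) (Finset.mem_univ _)
  have := e.le_iff_le.mp hHK h'
  simpa [H, K] using this

/-- By surjectivity of the join map, `z` is a join of elements `H g ≤ g`, and each of these lies
below `z ⊓ g`. -/
theorem IsBuildingSet.sup_inf_factors (hG : IsBuildingSet G) {F z : L} (hz : z ≤ F) :
    (factors G F).sup (fun h => z ⊓ h) = z := by
  refine le_antisymm (Finset.sup_le fun _ _ => inf_le_left) ?_
  obtain ⟨e, he⟩ := hG.2 F
  obtain ⟨H, hH⟩ := e.surjective ⟨z, hz⟩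
  rw [he] at hH
  have hH : Finset.univ.sup (fun g => (H g : L)) = z := congrArg Subtype.val hH
  conv_lhs => rw [← hH]
  refine Finset.sup_le fun g _ => ?_
  have h1 : (H g : L) ≤ z := by
    rw [← hH]; exact Finset.le_sup (f := fun g => (H g : L)) (Finset.mem_univ g)
  exact (le_inf h1 (H g).2).trans (Finset.le_sup (f := fun h => z ⊓ h) g.2)

theorem IsBuildingSet.sup_factors (hG : IsBuildingSet G) (F : L) : (factors G F).sup id = F := by
  conv_rhs => rw [← hG.sup_inf_factors (le_refl F)]
  exact Finset.sup_congr rfl fun h hh => (inf_eq_right.mpr (le_of_mem_factors hh)).symm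

theorem IsBuildingSet.eq_of_mem_factors (hG : IsBuildingSet G) {F g g' x : L}
    (hg : g ∈ factors G F) (hg' : g' ∈ factors G F) (hx : x ≠ ⊥) (hxg : x ≤ g) (hxg' : x ≤ g') :
    g = g' := by
  classical
  by_contra hne
  refine hx (le_bot_iff.mp (hG.le_of_le_sup_erase hg bot_le hxg ?_))
  exact (hxg'.trans (Finset.le_sup (f := id)
    (Finset.mem_erase.mpr ⟨Ne.symm hne, hg'⟩))).trans le_sup_right

theorem IsBuildingSet.exists_factor_ge_of_supIrred (hG : IsBuildingSet G) {F I : L}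
    (hI : SupIrred I) (hIF : I ≤ F) : ∃ h ∈ factors G F, I ≤ h := by
  obtain ⟨h, hh, heq⟩ := hI.finset_sup_eq (hG.sup_inf_factors hIF)
  exact ⟨h, hh, inf_eq_left.mp heq⟩

theorem IsBuildingSet.exists_factor_not_le (hG : IsBuildingSet G) {E F : L} (h : ¬ F ≤ E) :
    ∃ g ∈ factors G F, ¬ g ≤ E := by
  by_contra! hcon
  exact h (by rw [← hG.sup_factors F]; exact Finset.sup_le hcon)

end BuildingSet

/-! ### Nested sets -/

section Nested

variable {L : Type*} [Lattice L] [BoundedOrder L] {G S : Finset L}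

/-- Elements of `A` not below a factor `h` lie below other factors and cancel, so `h` is the join of
the elements of `A` below it. Nestedness allows only one such element, and `h ≠ ⊥` forces at least
one. -/
theorem IsNested.factors_sup_antichain (hG : IsBuildingSet G) (hS : IsNested G S) {A : Finset L}
    (hAS : A ⊆ S) (hA : IsAntichain (· ≤ ·) (A : Set L)) : factors G (A.sup id) = A := by
  classical
  have key : ∀ h ∈ factors G (A.sup id), h ∈ A := by
    intro h hh
    set B := A.filter (· ≤ h) with hB
    have hBh : B.sup id = h := by
      refine le_antisymm (Finset.sup_le fun a ha => (Finset.mem_filter.mp ha).2) ?_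
      refine hG.le_of_le_sup_erase hh (Finset.sup_le fun a ha => (Finset.mem_filter.mp ha).2)
        le_rfl ((le_of_mem_factors hh).trans (Finset.sup_le fun a ha => ?_))
      obtain ⟨h', hh', hah'⟩ := exists_factor_ge (hS.1 (hAS ha)) (Finset.le_sup (f := id) ha)
      by_cases heq : h' = h
      · subst heq
        exact le_sup_of_le_left (Finset.le_sup (f := id) (Finset.mem_filter.mpr ⟨ha, hah'⟩))
      · exact le_sup_of_le_right (hah'.trans (Finset.le_sup (f := id)
          (Finset.mem_erase.mpr ⟨heq, hh'⟩)))
    have hBA : B ⊆ A := Finset.filter_subset _ _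
    have hcard : ¬ 2 ≤ B.card := fun h2 =>
      hS.2 B (hBA.trans hAS) (hA.subset hBA) h2 (by rw [hBh]; exact mem_of_mem_factors hh)
    have hne : B.card ≠ 0 := by
      intro h0
      rw [Finset.card_eq_zero] at h0
      rw [h0, Finset.sup_empty] at hBh
      exact hG.ne_bot (mem_of_mem_factors hh) hBh.symm
    obtain ⟨b, hb⟩ := Finset.card_eq_one.mp (show B.card = 1 by omega)
    rw [hb, Finset.sup_singleton, id] at hBh
    exact hBh ▸ hBA (by rw [hb]; exact Finset.mem_singleton_self b)
  refine Finset.Subset.antisymm key fun a ha => ?_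
  obtain ⟨h, hh, hah⟩ := exists_factor_ge (hS.1 (hAS ha)) (Finset.le_sup (f := id) ha)
  rwa [hA.eq ha (key h hh) hah]

theorem IsNested.factors_sup (hG : IsBuildingSet G) (hS : IsNested G S) {M : Finset L}
    (hMS : M ⊆ S) {g : L} : g ∈ factors G (M.sup id) ↔ Maximal (· ∈ M) g := by
  classical
  set A := M.filter (fun g => Maximal (· ∈ M) g) with hA
  have hAM : A ⊆ M := Finset.filter_subset _ _
  have hanti : IsAntichain (· ≤ ·) (A : Set L) := by
    intro a ha b hb hne hab
    exact hne ((Finset.mem_filter.mp ha).2.eq_of_le (hAM hb) hab)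
  have hsup : A.sup id = M.sup id := by
    refine le_antisymm (Finset.sup_mono hAM) (Finset.sup_le fun m hm => ?_)
    obtain ⟨a, hma, ha⟩ := M.finite_toSet.exists_le_maximal (a := m) hm
    exact le_trans hma (Finset.le_sup (f := id) (Finset.mem_filter.mpr ⟨ha.prop, ha⟩))
  rw [← hsup, hS.factors_sup_antichain hG (hAM.trans hMS) hanti, Finset.mem_filter]
  exact ⟨fun h => h.2, fun h => ⟨h.prop, h⟩⟩

theorem IsNested.exists_ge_of_le_sup (hG : IsBuildingSet G) (hS : IsNested G S) {M : Finset L}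
    (hMS : M ⊆ S) {g : L} (hg : g ∈ G) (hle : g ≤ M.sup id) : ∃ m ∈ M, g ≤ m := by
  obtain ⟨h, hh, hgh⟩ := exists_factor_ge hg hle
  exact ⟨h, ((hS.factors_sup hG hMS).mp hh).prop, hgh⟩

theorem IsNested.subset {S T : Finset L} (hS : IsNested G S) (hTS : T ⊆ S) : IsNested G T :=
  ⟨hTS.trans hS.1, fun A hA => hS.2 A (hA.trans hTS)⟩

theorem IsNested.insert_top [DecidableEq L] (hS : IsNested G S) (htop : ⊤ ∈ G) :
    IsNested G (insert ⊤ S) := by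
  refine ⟨Finset.insert_subset htop hS.1, fun A hA hanti h2 => ?_⟩
  refine hS.2 A (fun a ha => ?_) hanti h2
  refine (Finset.mem_insert.mp (hA ha)).resolve_left fun hatop => ?_
  obtain ⟨b, hb, hne⟩ := Finset.exists_mem_ne (by omega : 1 < A.card) a
  exact hne (hanti.eq hb ha (hatop ▸ le_top))

/-- Elements of `S` with a common nonzero lower bound are comparable. -/
theorem IsNested.le_or_le (hG : IsBuildingSet G) (hS : IsNested G S) {a b x : L} (ha : a ∈ S)
    (hb : b ∈ S) (hx : x ≠ ⊥) (hxa : x ≤ a) (hxb : x ≤ b) : a ≤ b ∨ b ≤ a := by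
  classical
  by_contra! hcon
  have hanti : IsAntichain (· ≤ ·) ((({a, b} : Finset L) : Finset L) : Set L) := by
    intro u hu v hv hne huv
    simp only [Finset.coe_insert, Finset.coe_singleton, Set.mem_insert_iff,
      Set.mem_singleton_iff] at hu hv
    rcases hu with rfl | rfl <;> rcases hv with rfl | rfl <;> simp_all
  have hfac := hS.factors_sup_antichain hG
    (by intro u; simp only [Finset.mem_insert, Finset.mem_singleton]; rintro (rfl | rfl) <;> assumption)
    hanti
  refine hcon.1 (hG.eq_of_mem_factors (F := ({a, b} : Finset L).sup id) ?_ ?_ hx hxa hxb).le <;>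
    rw [hfac] <;> simp

/-- The factors of the elements of a chain form a nested set. -/
theorem isNested_of_factors_chain {C : Set L} (hC : IsChain (· ≤ ·) C)
    (hS : ∀ s ∈ S, ∃ F ∈ C, s ∈ factors G F) : IsNested G S := by
  classical
  refine ⟨fun s hs => let ⟨F, _, h⟩ := hS s hs; mem_of_mem_factors h, ?_⟩
  intro A hAS hanti h2 hsup
  choose! F hFC hF using hS
  -- Choose `a` with `F a` highest in the chain. If the join of `A` were in `G`, it would lie
  -- between the factor `a` and `F a`, hence equal `a`.
  obtain ⟨a, ha, hmax⟩ : ∃ a ∈ A, ∀ b ∈ A, F b ≤ F a := by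
    have hne : (A.image F).Nonempty := (Finset.card_pos.mp (by omega : 0 < A.card)).image F
    obtain ⟨x, hx⟩ := (A.image F).exists_maximal hne
    obtain ⟨a, ha, rfl⟩ := Finset.mem_image.mp hx.prop
    refine ⟨a, ha, fun b hb => ?_⟩
    rcases hC.total (hFC b (hAS hb)) (hFC a (hAS ha)) with h | h
    · exact h
    · exact hx.le_of_ge (Finset.mem_image_of_mem F hb) h
  have heq : A.sup id = a := eq_of_mem_factors_of_le (hF a (hAS ha)) hsup
    (Finset.sup_le fun b hb => (le_of_mem_factors (hF b (hAS hb))).trans (hmax b hb))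
    (Finset.le_sup (f := id) ha)
  obtain ⟨b, hb, hne⟩ := Finset.exists_mem_ne (by omega : 1 < A.card) a
  exact hne (hanti.eq hb ha (heq ▸ Finset.le_sup (f := id) hb))

end Nested

/-! ### Linear extensions and their chains of partial joins -/

section LinearExtension

/-- `m 0, …, m (|M| - 1)` enumerates the finite set `M` compatibly with the order. -/
structure IsLinExt {L : Type*} [LE L] (M : Finset L) (m : ℕ → L) : Prop where
  mem : ∀ i < M.card, m i ∈ M
  surj : ∀ x ∈ M, ∃ i < M.card, m i = x
  le_of_le : ∀ i < M.card, ∀ j < M.card, m i ≤ m j → i ≤ j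

/-- Sorting by a key `κ`. The key is the order itself, linearly extended, when any enumeration will
do, and a lexicographic pair in the uniqueness argument. -/
theorem exists_isLinExt {L α : Type*} [Preorder L] [Nonempty L] [LinearOrder α] (M : Finset L)
    (κ : L → α) (hinj : Set.InjOn κ M) (hmono : MonotoneOn κ M) :
    ∃ m, IsLinExt M m ∧ ∀ i < M.card, ∀ j < M.card, i ≤ j → κ (m i) ≤ κ (m j) := by
  classical
  have hcard : (M.image κ).card = M.card := Finset.card_image_of_injOn hinj
  let o := (M.image κ).orderIsoOfFin hcard
  have hex : ∀ i : Fin M.card, ∃ x ∈ M, κ x = o i := fun i => Finset.mem_image.mp (o i).2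
  choose x hxM hx using hex
  let m : ℕ → L := fun i => if h : i < M.card then x ⟨i, h⟩ else Classical.arbitrary L
  have hm : ∀ i (h : i < M.card), m i = x ⟨i, h⟩ := fun i h => dif_pos h
  have hle : ∀ i (hi : i < M.card) j (hj : j < M.card), κ (m i) ≤ κ (m j) ↔ i ≤ j := by
    intro i hi j hj
    rw [hm i hi, hm j hj, hx, hx]
    exact o.le_iff_le
  refine ⟨m, ⟨fun i hi => ?_, fun y hy => ?_, fun i hi j hj h => ?_⟩,
    fun i hi j hj h => (hle i hi j hj).mpr h⟩
  · rw [hm i hi]; exact hxM _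
  · obtain ⟨i, hi⟩ := o.surjective ⟨κ y, Finset.mem_image_of_mem κ hy⟩
    refine ⟨i, i.2, ?_⟩
    rw [hm i i.2]
    refine hinj (hxM _) hy ?_
    rw [hx, Fin.eta, hi]
  · refine (hle i hi j hj).mp (hmono ?_ ?_ h)
    · rw [hm i hi]; exact hxM _
    · rw [hm j hj]; exact hxM _

theorem exists_isLinExt_of_partialOrder {L : Type*} [PartialOrder L] [Nonempty L] (M : Finset L) :
    ∃ m, IsLinExt M m := by
  obtain ⟨m, hm, -⟩ := exists_isLinExt M (toLinearExtension : L → LinearExtension L)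
    (fun _ _ _ _ h => h) (fun _ _ _ _ h => toLinearExtension.monotone h)
  exact ⟨m, hm⟩

/-- The join of the first `r` terms of a sequence. -/
def partialJoin {L : Type*} [SemilatticeSup L] [OrderBot L] (m : ℕ → L) (r : ℕ) : L :=
  (Finset.range r).sup m

variable {L : Type*} [Lattice L] [BoundedOrder L] {G M : Finset L} {m : ℕ → L}

theorem partialJoin_succ (r : ℕ) : partialJoin m (r + 1) = partialJoin m r ⊔ m r := by
  rw [partialJoin, Finset.range_add_one, Finset.sup_insert, sup_comm, partialJoin]

theorem partialJoin_mono : Monotone (partialJoin m) := fun _ _ h =>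
  Finset.sup_mono (Finset.range_mono h)

theorem le_partialJoin {i r : ℕ} (h : i < r) : m i ≤ partialJoin m r :=
  Finset.le_sup (Finset.mem_range.mpr h)

theorem partialJoin_eq_sup_image [DecidableEq L] (r : ℕ) :
    partialJoin m r = ((Finset.range r).image m).sup id := by
  rw [Finset.sup_image]; rfl

namespace IsLinExt

theorem eq_of_eq {L : Type*} [Preorder L] {M : Finset L} {m : ℕ → L} (e : IsLinExt M m) {i j : ℕ}
    (hi : i < M.card) (hj : j < M.card) (h : m i = m j) : i = j :=
  le_antisymm (e.le_of_le i hi j hj h.le) (e.le_of_le j hj i hi h.ge)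

theorem image_subset {L : Type*} [LE L] {M : Finset L} {m : ℕ → L} [DecidableEq L]
    (e : IsLinExt M m) {r : ℕ} (hr : r ≤ M.card) :
    (Finset.range r).image m ⊆ M := by
  intro x hx
  obtain ⟨i, hi, rfl⟩ := Finset.mem_image.mp hx
  exact e.mem i ((Finset.mem_range.mp hi).trans_le hr)

theorem mem_factors_partialJoin (e : IsLinExt M m) (hG : IsBuildingSet G) (hM : IsNested G M)
    {r : ℕ} (hr : r < M.card) : m r ∈ factors G (partialJoin m (r + 1)) := by
  classical
  rw [partialJoin_eq_sup_image, hM.factors_sup hG (e.image_subset hr)]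
  refine ⟨Finset.mem_image_of_mem m (by simp), fun x hx hle => ?_⟩
  obtain ⟨i, hi, rfl⟩ := Finset.mem_image.mp hx
  rw [Finset.mem_range] at hi
  have := e.le_of_le r hr i (by omega) hle
  rw [show i = r by omega]

theorem exists_of_mem_factors_partialJoin (e : IsLinExt M m) (hG : IsBuildingSet G)
    (hM : IsNested G M) {r : ℕ} (hr : r ≤ M.card) {g : L}
    (hg : g ∈ factors G (partialJoin m r)) : ∃ i < r, m i = g := by
  classical
  rw [partialJoin_eq_sup_image, hM.factors_sup hG (e.image_subset hr)] at hg
  simpa using hg.prop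

theorem exists_le_of_le_partialJoin (e : IsLinExt M m) (hG : IsBuildingSet G) (hM : IsNested G M)
    {r : ℕ} (hr : r ≤ M.card) {g : L} (hg : g ∈ G) (hle : g ≤ partialJoin m r) :
    ∃ i < r, g ≤ m i := by
  obtain ⟨h, hh, hgh⟩ := exists_factor_ge hg hle
  obtain ⟨i, hi, rfl⟩ := e.exists_of_mem_factors_partialJoin hG hM hr hh
  exact ⟨i, hi, hgh⟩

theorem not_le_partialJoin (e : IsLinExt M m) (hG : IsBuildingSet G) (hM : IsNested G M)
    {r : ℕ} (hr : r < M.card) : ¬ m r ≤ partialJoin m r := by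
  intro h
  obtain ⟨i, hi, hle⟩ := e.exists_le_of_le_partialJoin hG hM hr.le (hM.1 (e.mem r hr)) h
  have := e.le_of_le r hr i (by omega) hle
  omega

theorem partialJoin_lt (e : IsLinExt M m) (hG : IsBuildingSet G) (hM : IsNested G M)
    {r : ℕ} (hr : r < M.card) : partialJoin m r < partialJoin m (r + 1) :=
  lt_of_le_of_ne (partialJoin_mono (Nat.le_succ r)) fun h =>
    e.not_le_partialJoin hG hM hr (h ▸ le_partialJoin (Nat.lt_succ_self r))

theorem partialJoin_lt_iff (e : IsLinExt M m) (hG : IsBuildingSet G) (hM : IsNested G M)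
    {i r : ℕ} (hi : i < M.card) : m i ≤ partialJoin m r ↔ i < r := by
  refine ⟨fun h => ?_, le_partialJoin⟩
  by_contra hcon
  exact e.not_le_partialJoin hG hM hi (h.trans (partialJoin_mono (not_lt.mp hcon)))

/-- Each term strictly enlarges the join. This bounds `M.card` by `grade ⊤`; equality leaves no
slack, so every step is then a cover. -/
theorem grade_partialJoin_add_le [GradeOrder ℕ L] (e : IsLinExt M m) (hG : IsBuildingSet G)
    (hM : IsNested G M) (r k : ℕ) (hrk : r + k ≤ M.card) :
    grade ℕ (partialJoin m r) + k ≤ grade ℕ (partialJoin m (r + k)) := by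
  induction k with
  | zero => simp
  | succ k ih =>
    have h1 := ih (by omega)
    have h2 : grade ℕ (partialJoin m (r + k)) < grade ℕ (partialJoin m (r + k + 1)) :=
      grade_strictMono (e.partialJoin_lt hG hM (by omega))
    rw [add_assoc] at h2
    omega

theorem card_le_grade_top [GradeOrder ℕ L] (e : IsLinExt M m) (hG : IsBuildingSet G)
    (hM : IsNested G M) : M.card ≤ grade ℕ (⊤ : L) := by
  have h1 := e.grade_partialJoin_add_le hG hM 0 M.card (by omega)
  have h2 : grade ℕ (partialJoin m (0 + M.card)) ≤ grade ℕ (⊤ : L) := grade_mono le_top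
  omega

theorem grade_partialJoin [GradeOrder ℕ L] (e : IsLinExt M m) (hG : IsBuildingSet G)
    (hM : IsNested G M) (hcard : M.card = grade ℕ (⊤ : L)) {r : ℕ} (hr : r ≤ M.card) :
    grade ℕ (partialJoin m r) = r := by
  have h1 := e.grade_partialJoin_add_le hG hM 0 r (by omega)
  have h2 := e.grade_partialJoin_add_le hG hM r (M.card - r) (by omega)
  have h3 : grade ℕ (partialJoin m (r + (M.card - r))) ≤ grade ℕ (⊤ : L) := grade_mono le_top
  rw [zero_add] at h1
  omega

theorem partialJoin_covBy [GradeOrder ℕ L] (e : IsLinExt M m) (hG : IsBuildingSet G)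
    (hM : IsNested G M) (hcard : M.card = grade ℕ (⊤ : L)) {r : ℕ} (hr : r < M.card) :
    partialJoin m r ⋖ partialJoin m (r + 1) := by
  rw [covBy_iff_lt_covBy_grade (𝕆 := ℕ), e.grade_partialJoin hG hM hcard hr.le,
    e.grade_partialJoin hG hM hcard hr, Nat.covBy_iff_add_one_eq]
  exact ⟨e.partialJoin_lt hG hM hr, rfl⟩

theorem partialJoin_card [GradeOrder ℕ L] (e : IsLinExt M m) (hG : IsBuildingSet G)
    (hM : IsNested G M) (hcard : M.card = grade ℕ (⊤ : L)) : partialJoin m M.card = ⊤ := by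
  by_contra hne
  have := grade_strictMono (𝕆 := ℕ) (lt_top_iff_ne_top.mpr hne)
  rw [e.grade_partialJoin hG hM hcard le_rfl] at this
  omega

/-- A nested set can be recovered from its chain of partial joins alone; uniqueness rests on this.
-/
theorem mem_iff_mem_factors (e : IsLinExt M m) (hG : IsBuildingSet G) (hM : IsNested G M) {g : L} :
    g ∈ M ↔ ∃ r < M.card, g ∈ factors G (partialJoin m (r + 1)) := by
  constructor
  · intro hg
    obtain ⟨r, hr, rfl⟩ := e.surj g hg
    exact ⟨r, hr, e.mem_factors_partialJoin hG hM hr⟩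
  · rintro ⟨r, hr, hg⟩
    obtain ⟨i, hi, rfl⟩ := e.exists_of_mem_factors_partialJoin hG hM hr hg
    exact e.mem i (by omega)

end IsLinExt

/-- A saturated chain from `⊥` to `⊤` is the chain of partial joins of a nested set. -/
theorem exists_isNested_of_saturated (hG : IsBuildingSet G) {F : ℕ → L} {n : ℕ} (h0 : F 0 = ⊥)
    (hF : ∀ i < n, F i ⋖ F (i + 1)) :
    ∃ (M : Finset L) (m : ℕ → L), IsNested G M ∧ IsLinExt M m ∧ M.card = n ∧
      ∀ r ≤ n, partialJoin m r = F r := by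
  classical
  have hmono : ∀ i j, i ≤ j → j ≤ n → F i ≤ F j := by
    intro i j hij
    induction j, hij using Nat.le_induction with
    | base => exact fun _ => le_rfl
    | succ j hij ih => exact fun h => (ih (by omega)).trans (hF j (by omega)).le
  -- The new element at step `r` is a factor of `F (r + 1)` not below `F r`; beyond `n` the value
  -- `⊥` is junk.
  have hex : ∀ r, ∃ g, r < n → g ∈ factors G (F (r + 1)) ∧ ¬ g ≤ F r := by
    intro r
    by_cases hr : r < n
    · obtain ⟨g, hg⟩ := hG.exists_factor_not_le (hF r hr).lt.not_ge
      exact ⟨g, fun _ => hg⟩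
    · exact ⟨⊥, fun h => absurd h hr⟩
  choose m hm using hex
  have hle : ∀ i < n, ∀ j < n, m i ≤ m j → i ≤ j := by
    intro i hi j hj h
    by_contra hcon
    exact (hm i hi).2 (h.trans ((le_of_mem_factors (hm j hj).1).trans
      (hmono _ _ (by omega) (by omega))))
  have hcard : ((Finset.range n).image m).card = n := by
    rw [Finset.card_image_of_injOn, Finset.card_range]
    intro i hi j hj h
    rw [Finset.mem_coe, Finset.mem_range] at hi hj
    exact le_antisymm (hle i hi j hj h.le) (hle j hj i hi h.ge)
  have hsup : ∀ r ≤ n, partialJoin m r = F r := by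
    intro r
    induction r with
    | zero => intro _; rw [h0]; rfl
    | succ r ih =>
      intro hr
      rw [partialJoin_succ, ih (by omega)]
      have hmr := hm r (by omega)
      refine ((hF r (by omega)).eq_or_eq le_sup_left
        (sup_le (hF r (by omega)).le (le_of_mem_factors hmr.1))).resolve_left fun h => ?_
      exact hmr.2 (h ▸ le_sup_right)
  refine ⟨(Finset.range n).image m, m, ?_, ⟨?_, ?_, ?_⟩, hcard, hsup⟩
  · refine isNested_of_factors_chain (C := F '' Set.Iic n) ?_ ?_
    · rintro _ ⟨i, hi, rfl⟩ _ ⟨j, hj, rfl⟩ -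
      rcases le_total i j with h | h
      · exact Or.inl (hmono i j h hj)
      · exact Or.inr (hmono j i h hi)
    · intro s hs
      obtain ⟨i, hi, rfl⟩ := Finset.mem_image.mp hs
      rw [Finset.mem_range] at hi
      exact ⟨F (i + 1), ⟨i + 1, hi, rfl⟩, (hm i hi).1⟩
  · rw [hcard]
    exact fun i hi => Finset.mem_image_of_mem m (Finset.mem_range.mpr hi)
  · rw [hcard]
    intro x hx
    simpa using hx
  · rw [hcard]; exact hle

end LinearExtension

/-! ### Labels of chains and of nested sets -/

section Labels

variable {L : Type*} [Lattice L] [BoundedOrder L] {G M : Finset L} {m : ℕ → L}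
  {ω : {I : L // SupIrred I} → ℕ+}

theorem exists_label_eq [Fintype L] {a b : L} (hab : a ⋖ b) :
    ∃ I : {I : L // SupIrred I}, a ⊔ (I : L) = b ∧ (ω I : ℕ) = label ω a b := by
  refine Nat.sInf_mem (s := {n : ℕ | ∃ I : {I : L // SupIrred I}, a ⊔ (I : L) = b ∧ (ω I : ℕ) = n}) ?_
  obtain ⟨s, hs, hirr⟩ := exists_supIrred_decomposition b
  obtain ⟨I, hI, hIa⟩ : ∃ I ∈ s, ¬ I ≤ a := by
    by_contra! hcon
    exact hab.lt.not_ge (hs ▸ Finset.sup_le hcon)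
  refine ⟨_, ⟨I, hirr hI⟩, ?_, rfl⟩
  have hIb : I ≤ b := hs ▸ Finset.le_sup (f := id) hI
  exact (hab.eq_or_eq le_sup_left (sup_le hab.le hIb)).resolve_left fun h => hIa (h ▸ le_sup_right)

/-- The labels along a saturated chain are distinct. -/
theorem label_ne_label [Fintype L] (hinj : Function.Injective ω) {a b c d : L} (hab : a ⋖ b) (hbc : b ≤ c)
    (hcd : c ⋖ d) : label ω a b ≠ label ω c d := by
  intro h
  obtain ⟨I, hI, hIω⟩ := exists_label_eq (ω := ω) hab
  obtain ⟨J, hJ, hJω⟩ := exists_label_eq (ω := ω) hcd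
  -- Equal labels come from one irreducible, which is already below `c` and so cannot lift `c` to
  -- `d`.
  have hIJ : I = J := hinj (PNat.coe_injective (by rw [hIω, hJω, h]))
  subst hIJ
  have : (I : L) ≤ c := (le_sup_right.trans hI.le).trans hbc
  exact hcd.ne (by rw [← hJ, sup_eq_left.mpr this])

/-- The same irreducibles realise both steps, so both labels are minima of one set. Such an
irreducible lies below a single factor of the new join, necessarily `m r`, and the other factors
cancel. -/
theorem IsLinExt.label_partialJoin (e : IsLinExt M m) (hG : IsBuildingSet G) (hM : IsNested G M)
    (ω : {I : L // SupIrred I} → ℕ+) {r : ℕ} (hr : r < M.card) :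
    label ω (partialJoin m r) (partialJoin m (r + 1)) = nestedLabel ω M (m r) := by
  classical
  unfold nestedLabel label
  have hlow : lowerJoin M (m r) = (M.filter (· < m r)).sup id := by
    unfold lowerJoin
    congr
  have hlow_le : lowerJoin M (m r) ≤ partialJoin m r := by
    rw [hlow]
    refine Finset.sup_le fun x hx => ?_
    rw [Finset.mem_filter] at hx
    obtain ⟨i, hi, rfl⟩ := e.surj x hx.1
    have h1 := e.le_of_le i hi r hr hx.2.le
    have h2 : i ≠ r := fun h => hx.2.ne (by rw [h])
    exact le_partialJoin (by omega)
  have hlow_m : lowerJoin M (m r) ≤ m r := by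
    rw [hlow]
    exact Finset.sup_le fun x hx => (Finset.mem_filter.mp hx).2.le
  have hfac := e.mem_factors_partialJoin hG hM hr
  congr 1
  ext k
  refine exists_congr fun I => and_congr_left fun _ => ⟨fun h => ?_, fun h => ?_⟩
  · have hIle : (I : L) ≤ m r := by
      obtain ⟨h', hh', hIh'⟩ := hG.exists_factor_ge_of_supIrred I.2 (le_sup_right.trans h.le)
      obtain ⟨i, hi, rfl⟩ := e.exists_of_mem_factors_partialJoin hG hM hr hh'
      by_cases hir : i = r
      · rwa [hir] at hIh'
      · exfalso
        have h1 : (I : L) ≤ partialJoin m r := hIh'.trans (le_partialJoin (by omega))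
        rw [sup_eq_left.mpr h1] at h
        exact (e.partialJoin_lt hG hM hr).ne h
    refine le_antisymm (sup_le hlow_m hIle) ?_
    refine hG.le_of_le_sup_erase hfac (sup_le hlow_m hIle) le_rfl ?_
    refine (le_of_mem_factors hfac).trans (h.ge.trans (sup_le (Finset.sup_le fun i hi => ?_) ?_))
    · rw [Finset.mem_range] at hi
      obtain ⟨h', hh', hih'⟩ := exists_factor_ge (hM.1 (e.mem i (by omega)))
        (le_partialJoin (m := m) (show i < r + 1 by omega))
      -- An earlier term either lies strictly below `m r`, hence in the lower join, or below a
      -- factor that gets cancelled.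
      by_cases heq : h' = m r
      · have hlt : m i < m r := by
          refine lt_of_le_of_ne (heq ▸ hih') fun h => ?_
          have := e.eq_of_eq (by omega) hr h
          omega
        refine le_trans ?_ (le_sup_left.trans le_sup_left)
        rw [hlow]
        exact Finset.le_sup (f := id) (Finset.mem_filter.mpr ⟨e.mem i (by omega), hlt⟩)
      · exact (hih'.trans (Finset.le_sup (f := id) (Finset.mem_erase.mpr ⟨heq, hh'⟩))).trans
          le_sup_right
    · exact le_sup_right.trans le_sup_left
  · rw [partialJoin_succ, ← h, ← sup_assoc, sup_eq_left.mpr hlow_le]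

end Labels

/-! ### Increasing saturated chains, indexed by grade -/

section IncreasingChains

variable {L : Type*} [Lattice L] {ω : {I : L // SupIrred I} → ℕ+}

/-- `F s ⋖ F (s + 1) ⋖ ⋯ ⋖ F t` is a saturated chain with weakly increasing labels. -/
structure IsIncreasingChain (ω : {I : L // SupIrred I} → ℕ+) (s t : ℕ) (F : ℕ → L) : Prop where
  covBy : ∀ i, s ≤ i → i < t → F i ⋖ F (i + 1)
  label_le : ∀ i, s ≤ i → i + 1 < t →
    label ω (F i) (F (i + 1)) ≤ label ω (F (i + 1)) (F (i + 2))

theorem isChain_chainLabels {l : List L} :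
    (chainLabels ω l).IsChain (· ≤ ·) ↔ ∀ i (h : i + 2 < l.length),
      label ω l[i] l[i + 1] ≤ label ω l[i + 1] l[i + 2] := by
  rw [List.isChain_iff_getElem]
  simp only [chainLabels, List.length_zipWith, List.length_tail, List.getElem_zipWith,
    List.getElem_tail]
  exact ⟨fun h i hi => h i (by omega), fun h i hi => h i (by omega)⟩

theorem IsAdmissible.exists_isIncreasingChain [GradeOrder ℕ L] (hadm : IsAdmissible ω) {a b : L}
    (hab : a ≤ b) : ∃ F : ℕ → L, F (grade ℕ a) = a ∧ F (grade ℕ b) = b ∧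
      IsIncreasingChain ω (grade ℕ a) (grade ℕ b) F := by
  obtain ⟨l, ⟨⟨hch, hhd, hlast⟩, hinc⟩, -⟩ := hadm a b hab
  rw [isChain_chainLabels] at hinc
  rw [List.isChain_iff_getElem] at hch
  have hpos : 0 < l.length := by
    rcases l with _ | ⟨x, l⟩
    · simp at hhd
    · simp
  have h0 : l[0] = a := by
    rw [List.head?_eq_getElem?, List.getElem?_eq_getElem hpos] at hhd
    exact Option.some_injective _ hhd
  have hl : l[l.length - 1] = b := by
    rw [List.getLast?_eq_getElem?, List.getElem?_eq_getElem (by omega)] at hlast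
    exact Option.some_injective _ hlast
  have hgrade : ∀ k (hk : k < l.length), grade ℕ l[k] = grade ℕ a + k := by
    intro k
    induction k with
    | zero => intro _; rw [h0]; rfl
    | succ k ih =>
      intro hk
      have h1 := (hch k hk).grade ℕ
      rw [Nat.covBy_iff_add_one_eq, ih (by omega)] at h1
      omega
  have hlen : grade ℕ b = grade ℕ a + (l.length - 1) := by
    rw [← hgrade _ (by omega), hl]
  -- Shifting by `grade a` makes index equal grade; the default `a` is never reached up to `grade
  -- b`.
  refine ⟨fun i => l.getD (i - grade ℕ a) a, ?_, ?_, ⟨fun i h1 h2 => ?_, fun i h1 h2 => ?_⟩⟩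
  · simp only [Nat.sub_self]
    rw [List.getD_eq_getElem _ _ hpos, h0]
  · simp only [hlen, Nat.add_sub_cancel_left]
    rw [List.getD_eq_getElem _ _ (by omega), hl]
  · obtain ⟨k, rfl⟩ := Nat.exists_eq_add_of_le h1
    simp only [add_assoc, Nat.add_sub_cancel_left]
    rw [List.getD_eq_getElem _ _ (by omega), List.getD_eq_getElem _ _ (by omega)]
    exact hch k (by omega)
  · obtain ⟨k, rfl⟩ := Nat.exists_eq_add_of_le h1
    simp only [add_assoc, Nat.add_sub_cancel_left]
    rw [List.getD_eq_getElem _ _ (by omega), List.getD_eq_getElem _ _ (by omega),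
      List.getD_eq_getElem _ _ (by omega)]
    exact hinc k (by omega)

theorem IsIncreasingChain.isSaturatedChain {s k : ℕ} {F : ℕ → L}
    (hF : IsIncreasingChain ω s (s + k) F) :
    IsSaturatedChain (F s) (F (s + k)) ((List.range (k + 1)).map fun j => F (s + j)) ∧
      (chainLabels ω ((List.range (k + 1)).map fun j => F (s + j))).IsChain (· ≤ ·) := by
  refine ⟨⟨?_, ?_, ?_⟩, ?_⟩
  · rw [List.isChain_iff_getElem]
    intro i hi
    simp only [List.length_map, List.length_range] at hi
    simp only [List.getElem_map, List.getElem_range]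
    exact hF.covBy (s + i) (by omega) (by omega)
  · simp [List.head?_eq_getElem?]
  · simp [List.getLast?_eq_getElem?]
  · rw [isChain_chainLabels]
    intro i hi
    simp only [List.length_map, List.length_range] at hi
    simp only [List.getElem_map, List.getElem_range]
    exact hF.label_le (s + i) (by omega) (by omega)

theorem IsAdmissible.eq_of_isIncreasingChain (hadm : IsAdmissible ω) {s t : ℕ} {F F' : ℕ → L}
    (hF : IsIncreasingChain ω s t F) (hF' : IsIncreasingChain ω s t F') (hs : F s = F' s)
    (ht : F t = F' t) {i : ℕ} (hsi : s ≤ i) (hit : i ≤ t) : F i = F' i := by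
  obtain ⟨k, rfl⟩ := Nat.exists_eq_add_of_le (hsi.trans hit)
  obtain ⟨j, rfl⟩ := Nat.exists_eq_add_of_le hsi
  have hmono : ∀ j ≤ k, F s ≤ F (s + j) := by
    intro j
    induction j with
    | zero => exact fun _ => le_rfl
    | succ j ih => exact fun h => (ih (by omega)).trans (hF.covBy (s + j) (by omega) (by omega)).le
  have h2 := hF'.isSaturatedChain
  rw [← hs, ← ht] at h2
  have heq := (hadm _ _ (hmono k le_rfl)).unique hF.isSaturatedChain h2
  have := congrArg (fun l => l[j]?) heq
  simpa [List.getElem?_map, List.getElem?_range (show j < k + 1 by omega)] using this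

end IncreasingChains

/-! ### Chains refining a given flag -/

section ChainsThrough

variable {L : Type*} [Lattice L] [BoundedOrder L] {ω : {I : L // SupIrred I} → ℕ+} {C : Finset L}

/-- `⊥ = F 0 ⋖ F 1 ⋖ ⋯ ⋖ F n = ⊤` is a saturated chain through all elements of `C` whose labels
decrease only at elements of `C`. -/
structure IsIncreasingOff (ω : {I : L // SupIrred I} → ℕ+) (C : Finset L) (n : ℕ) (F : ℕ → L) :
    Prop where
  zero : F 0 = ⊥
  last : F n = ⊤
  covBy : ∀ i < n, F i ⋖ F (i + 1)
  through : ∀ c ∈ C, ∃ r ≤ n, F r = c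
  label_le : ∀ i, i + 1 < n → F (i + 1) ∉ C →
    label ω (F i) (F (i + 1)) ≤ label ω (F (i + 1)) (F (i + 2))

theorem exists_adjacent_of_isChain [GradeMinOrder ℕ L] (hC : IsChain (· ≤ ·) (C : Set L))
    (hbot : ⊥ ∈ C) (htop : ⊤ ∈ C) {r : ℕ} (hr : r < grade ℕ (⊤ : L)) :
    ∃ a ∈ C, ∃ b ∈ C, grade ℕ a ≤ r ∧ r < grade ℕ b ∧ (∀ c ∈ C, grade ℕ c ≤ r → c ≤ a) ∧
      ∀ c ∈ C, r < grade ℕ c → b ≤ c := by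
  classical
  have hle : ∀ a ∈ C, ∀ c ∈ C, grade ℕ a ≤ grade ℕ c → a ≤ c := by
    intro a ha c hc h
    rcases hC.total ha hc with h1 | h1
    · exact h1
    · rcases h1.eq_or_lt with h2 | h2
      · exact h2.ge
      · have := grade_strictMono (𝕆 := ℕ) h2
        omega
  have hgb : grade ℕ (⊥ : L) = 0 := grade_bot
  obtain ⟨a, ha, hamax⟩ := (C.filter (grade ℕ · ≤ r)).exists_max_image (grade ℕ)
    ⟨⊥, Finset.mem_filter.mpr ⟨hbot, by omega⟩⟩
  obtain ⟨b, hb, hbmin⟩ := (C.filter (r < grade ℕ ·)).exists_min_image (grade ℕ)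
    ⟨⊤, Finset.mem_filter.mpr ⟨htop, hr⟩⟩
  rw [Finset.mem_filter] at ha hb
  exact ⟨a, ha.1, b, hb.1, ha.2, hb.2,
    fun c hc h => hle c hc a ha.1 (hamax c (Finset.mem_filter.mpr ⟨hc, h⟩)),
    fun c hc h => hle b hb.1 c hc (hbmin c (Finset.mem_filter.mpr ⟨hc, h⟩))⟩

/-- Glue the increasing chains of the intervals between consecutive elements `lo r`, `hi r` of `C`.
-/
theorem IsAdmissible.exists_isIncreasingOff [GradeMinOrder ℕ L] (hadm : IsAdmissible ω)
    (hC : IsChain (· ≤ ·) (C : Set L)) (hbot : ⊥ ∈ C) (htop : ⊤ ∈ C) :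
    ∃ F, IsIncreasingOff ω C (grade ℕ (⊤ : L)) F := by
  have hf : ∀ a b : L, ∃ F : ℕ → L, a ≤ b → F (grade ℕ a) = a ∧ F (grade ℕ b) = b ∧
      IsIncreasingChain ω (grade ℕ a) (grade ℕ b) F := by
    intro a b
    by_cases hab : a ≤ b
    · obtain ⟨F, hF⟩ := hadm.exists_isIncreasingChain hab
      exact ⟨F, fun _ => hF⟩
    · exact ⟨fun _ => ⊥, fun h => absurd h hab⟩
  choose f hf using hf
  have hadj := fun r (hr : r < grade ℕ (⊤ : L)) => exists_adjacent_of_isChain hC hbot htop hr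
  choose! lo hlo hi hhi hlo_le hhi_lt hlo_max hhi_min using hadj
  have hlohi : ∀ r < grade ℕ (⊤ : L), lo r ≤ hi r := by
    intro r hr
    rcases hC.total (hlo r hr) (hhi r hr) with h | h
    · exact h
    · have h1 := grade_mono (𝕆 := ℕ) h
      have h2 := hlo_le r hr
      have h3 := hhi_lt r hr
      omega
  let F : ℕ → L := fun r => if r < grade ℕ (⊤ : L) then f (lo r) (hi r) r else ⊤
  have hFlt : ∀ r < grade ℕ (⊤ : L), F r = f (lo r) (hi r) r := fun r hr => if_pos hr
  have hgrade_lt : ∀ c : L, c ≠ ⊤ → grade ℕ c < grade ℕ (⊤ : L) := fun c hc =>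
    grade_strictMono (lt_top_iff_ne_top.mpr hc)
  have hFC : ∀ c ∈ C, F (grade ℕ c) = c := by
    intro c hc
    by_cases hct : c = ⊤
    · subst hct; exact if_neg (lt_irrefl _)
    · have hr := hgrade_lt c hct
      have hloc : lo (grade ℕ c) = c := by
        have h1 := hlo_max _ hr c hc le_rfl
        rcases h1.eq_or_lt with h2 | h2
        · exact h2.symm
        · have := grade_strictMono (𝕆 := ℕ) h2
          have := hlo_le _ hr
          omega
      have := (hf (lo (grade ℕ c)) (hi (grade ℕ c)) (hlohi _ hr)).1
      rw [hFlt _ hr]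
      rwa [hloc] at this ⊢
  -- The piece is also valid at its right end, where `F` already switches to the next piece (or to
  -- `⊤`); the last cover of each piece needs this.
  have hFeq : ∀ r < grade ℕ (⊤ : L), ∀ i, grade ℕ (lo r) ≤ i → i ≤ grade ℕ (hi r) →
      F i = f (lo r) (hi r) i := by
    intro r hr i h1 h2
    rcases h2.eq_or_lt with h3 | h3
    · rw [h3, hFC _ (hhi r hr), (hf _ _ (hlohi r hr)).2.1]
    · have hi' : i < grade ℕ (⊤ : L) := h3.trans_le (grade_mono le_top)
      have hloi : lo i = lo r := by
        refine le_antisymm (hlo_max r hr _ (hlo i hi') ?_) (hlo_max i hi' _ (hlo r hr) h1)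
        by_contra hcon
        have h4 := grade_mono (𝕆 := ℕ) (hhi_min r hr _ (hlo i hi') (not_le.mp hcon))
        have h5 := hlo_le i hi'
        omega
      have hhii : hi i = hi r := by
        refine le_antisymm (hhi_min i hi' _ (hhi r hr) h3) (hhi_min r hr _ (hhi i hi') ?_)
        by_contra hcon
        have h4 := grade_mono (𝕆 := ℕ) (hlo_max r hr _ (hhi i hi') (not_lt.mp hcon))
        have h5 := hhi_lt i hi'
        omega
      rw [hFlt i hi', hloi, hhii]
  refine ⟨F, ?_, hFC ⊤ htop, fun r hr => ?_,
    fun c hc => ⟨grade ℕ c, grade_mono le_top, hFC c hc⟩, fun r hr hrC => ?_⟩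
  · have := hFC ⊥ hbot
    rwa [show grade ℕ (⊥ : L) = 0 from grade_bot] at this
  · have h1 := hlo_le r hr
    have h2 := hhi_lt r hr
    rw [hFeq r hr r h1 h2.le, hFeq r hr (r + 1) (by omega) h2]
    exact (hf _ _ (hlohi r hr)).2.2.covBy r h1 h2
  · have hr' : r < grade ℕ (⊤ : L) := by omega
    have h1 := hlo_le r hr'
    have h2 := hhi_lt r hr'
    have h3 : r + 1 ≠ grade ℕ (hi r) := by
      intro h
      rw [h, hFC _ (hhi r hr')] at hrC
      exact hrC (hhi r hr')
    rw [hFeq r hr' r h1 h2.le, hFeq r hr' (r + 1) (by omega) h2,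
      hFeq r hr' (r + 2) (by omega) (by omega)]
    exact (hf _ _ (hlohi r hr')).2.2.label_le r h1 (by omega)

theorem IsIncreasingOff.grade_apply [GradeMinOrder ℕ L] {n : ℕ} {F : ℕ → L}
    (hF : IsIncreasingOff ω C n F) {r : ℕ} (hr : r ≤ n) : grade ℕ (F r) = r := by
  induction r with
  | zero => rw [hF.zero]; exact grade_bot
  | succ r ih =>
    have := (hF.covBy r hr).grade ℕ
    rw [Nat.covBy_iff_add_one_eq, ih (by omega)] at this
    exact this.symm

theorem IsIncreasingOff.apply_grade [GradeMinOrder ℕ L] {n : ℕ} {F : ℕ → L}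
    (hF : IsIncreasingOff ω C n F) {c : L} (hc : c ∈ C) : F (grade ℕ c) = c := by
  obtain ⟨r, hr, rfl⟩ := hF.through c hc
  rw [hF.grade_apply hr]

/-- Strictly between adjacent elements of `C` no label may fall, so each piece is the unique
increasing chain of its interval. -/
theorem IsAdmissible.eq_of_isIncreasingOff [GradeMinOrder ℕ L] (hadm : IsAdmissible ω)
    (hC : IsChain (· ≤ ·) (C : Set L)) (hbot : ⊥ ∈ C) (htop : ⊤ ∈ C) {F F' : ℕ → L}
    (hF : IsIncreasingOff ω C (grade ℕ (⊤ : L)) F) (hF' : IsIncreasingOff ω C (grade ℕ (⊤ : L)) F')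
    {r : ℕ} (hr : r ≤ grade ℕ (⊤ : L)) : F r = F' r := by
  rcases hr.eq_or_lt with h | hr
  · rw [h, hF.last, hF'.last]
  obtain ⟨a, ha, b, hb, har, hrb, hmax, hmin⟩ := exists_adjacent_of_isChain hC hbot htop hr
  have hbn : grade ℕ b ≤ grade ℕ (⊤ : L) := grade_mono le_top
  have key : ∀ F, IsIncreasingOff ω C (grade ℕ (⊤ : L)) F →
      IsIncreasingChain ω (grade ℕ a) (grade ℕ b) F := by
    refine fun F hF => ⟨fun i _ hi => hF.covBy i (by omega), fun i hai hib => ?_⟩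
    refine hF.label_le i (by omega) fun hiC => ?_
    have hg := hF.grade_apply (r := i + 1) (by omega)
    rcases Nat.lt_or_ge r (i + 1) with h | h
    · have := grade_mono (𝕆 := ℕ) (hmin _ hiC (by omega))
      omega
    · have := grade_mono (𝕆 := ℕ) (hmax _ hiC (by omega))
      omega
  refine hadm.eq_of_isIncreasingChain (key F hF) (key F' hF') ?_ ?_ har hrb.le
  · rw [hF.apply_grade ha, hF'.apply_grade ha]
  · rw [hF.apply_grade hb, hF'.apply_grade hb]

end ChainsThrough

/-! ### The nested set determined by a flag -/

section Flags

variable {L : Type*} [Lattice L] [BoundedOrder L] {G T M : Finset L} {C : Finset L}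
  {ω : {I : L // SupIrred I} → ℕ+}

/-- `C` is a chain of joins of subsets of `T`, from `⊥` to `⊤`, such that all elements of `T` are
factors of elements of `C`. -/
structure IsFactorFlag (G T C : Finset L) : Prop where
  isChain : IsChain (· ≤ ·) (C : Set L)
  bot_mem : ⊥ ∈ C
  top_mem : ⊤ ∈ C
  eq_sup : ∀ c ∈ C, ∃ U ⊆ T, U.sup id = c
  mem_factors : ∀ t ∈ T, ∃ c ∈ C, t ∈ factors G c

theorem IsNested.exists_isFactorFlag (hG : IsBuildingSet G) (hT : IsNested G T) (htop : ⊤ ∈ T) :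
    ∃ C, IsFactorFlag G T C := by
  classical
  obtain ⟨t, e⟩ := exists_isLinExt_of_partialOrder T
  have hmem : ∀ r ≤ T.card, partialJoin t r ∈ (Finset.range (T.card + 1)).image (partialJoin t) :=
    fun r hr => Finset.mem_image_of_mem _ (Finset.mem_range.mpr (by omega))
  refine ⟨(Finset.range (T.card + 1)).image (partialJoin t), ?_, hmem 0 (by omega), ?_, ?_, ?_⟩
  · intro x hx y hy _
    obtain ⟨i, -, rfl⟩ := Finset.mem_image.mp hx
    obtain ⟨j, -, rfl⟩ := Finset.mem_image.mp hy
    exact (le_total i j).imp (fun h => partialJoin_mono h) (fun h => partialJoin_mono h)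
  · obtain ⟨r, hr, hrt⟩ := e.surj ⊤ htop
    have h1 := le_partialJoin (m := t) (Nat.lt_succ_self r)
    rw [hrt, top_le_iff] at h1
    rw [← h1]
    exact hmem _ hr
  · intro c hc
    obtain ⟨r, hr, rfl⟩ := Finset.mem_image.mp hc
    rw [Finset.mem_range] at hr
    exact ⟨_, e.image_subset (by omega), (partialJoin_eq_sup_image r).symm⟩
  · intro x hx
    obtain ⟨r, hr, rfl⟩ := e.surj x hx
    exact ⟨_, hmem (r + 1) hr, e.mem_factors_partialJoin hG hT hr⟩

/-- The elements of `M` outside `T` are not descents with respect to their parents in `M`. -/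
def DescentsIn (ω : {I : L // SupIrred I} → ℕ+) (M T : Finset L) : Prop :=
  ∀ g ∈ M, g ∉ T → ∀ p, IsLeast {x | x ∈ M ∧ g < x} p → nestedLabel ω M g ≤ nestedLabel ω M p

/-- Elements of `M` above `g ≠ ⊥` are pairwise comparable, so a minimal one is least. -/
theorem IsNested.exists_isLeast (hG : IsBuildingSet G) (hM : IsNested G M) {g h : L} (hg : g ∈ M)
    (hh : h ∈ M) (hgh : g < h) : ∃ p, IsLeast {x | x ∈ M ∧ g < x} p ∧ p ≤ h := by
  classical
  have hfin : {x | x ∈ M ∧ g < x}.Finite := M.finite_toSet.subset fun x hx => hx.1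
  obtain ⟨p, hph, hp⟩ := hfin.exists_le_minimal (a := h) ⟨hh, hgh⟩
  refine ⟨p, ⟨hp.prop, fun x hx => ?_⟩, hph⟩
  rcases hM.le_or_le hG hp.prop.1 hx.1 (hG.ne_bot (hM.1 hg)) hp.prop.2.le hx.2.le with h1 | h1
  · exact h1
  · exact hp.le_of_le hx h1

variable [GradeMinOrder ℕ L]

theorem IsFactorFlag.exists_isNested (hG : IsBuildingSet G) (hadm : IsAdmissible ω)
    (hC : IsFactorFlag G T C) :
    ∃ M, IsNested G M ∧ T ⊆ M ∧ M.card = grade ℕ (⊤ : L) ∧ DescentsIn ω M T := by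
  obtain ⟨F, hF⟩ := hadm.exists_isIncreasingOff hC.isChain hC.bot_mem hC.top_mem
  obtain ⟨M, m, hM, e, hcard, hmF⟩ := exists_isNested_of_saturated hG hF.zero hF.covBy
  have hTM : T ⊆ M := by
    intro t ht
    obtain ⟨c, hc, htc⟩ := hC.mem_factors t ht
    obtain ⟨r, hr, rfl⟩ := hF.through c hc
    rw [← hmF r hr] at htc
    obtain ⟨i, hi, rfl⟩ := e.exists_of_mem_factors_partialJoin hG hM (by omega) htc
    exact e.mem i (by omega)
  refine ⟨M, hM, hTM, hcard, fun g hg hgT p hp => ?_⟩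
  obtain ⟨k, hk, rfl⟩ := e.surj g hg
  obtain ⟨l, hl, rfl⟩ := e.surj p hp.1.1
  have hkl : k < l := by
    refine lt_of_le_of_ne (e.le_of_le k hk l hl hp.1.2.le) fun h => ?_
    exact hp.1.2.ne (by rw [h])
  -- A member of `C` above `m k` is a join from `T`, so some `u ∈ T` lies above `m k`, strictly as
  -- `m k ∉ T`. Then `u` is above the parent `m l`, which would have entered the chain already.
  have hnotC : ∀ i, k < i → i ≤ l → F i ∉ C := by
    intro i hki hil hiC
    obtain ⟨U, hU, hUsup⟩ := hC.eq_sup _ hiC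
    have hki' : m k ≤ F i := by rw [← hmF i (by omega)]; exact le_partialJoin hki
    obtain ⟨u, hu, hku⟩ := hM.exists_ge_of_le_sup hG (hU.trans hTM) (hM.1 hg) (hki'.trans hUsup.ge)
    have hlt : m k < u := lt_of_le_of_ne hku fun h => hgT (h ▸ hU hu)
    have hpi : m l ≤ F i := (hp.2 ⟨hTM (hU hu), hlt⟩).trans
      ((Finset.le_sup (f := id) hu).trans hUsup.le)
    rw [← hmF i (by omega)] at hpi
    have := (e.partialJoin_lt_iff hG hM hl).mp hpi
    omega
  have hlab : ∀ i < M.card, nestedLabel ω M (m i) = label ω (F i) (F (i + 1)) := by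
    intro i hi
    rw [← e.label_partialJoin hG hM ω hi, hmF i (by omega), hmF (i + 1) (by omega)]
  have hmain : ∀ i, k ≤ i → i ≤ l → nestedLabel ω M (m k) ≤ nestedLabel ω M (m i) := by
    intro i hki
    induction i, hki using Nat.le_induction with
    | base => exact fun _ => le_rfl
    | succ i hki ih =>
      intro hil
      refine (ih (by omega)).trans ?_
      rw [hlab i (by omega), hlab (i + 1) (by omega)]
      exact hF.label_le i (by omega) (hnotC (i + 1) (by omega) hil)
  exact hmain l hkl.le le_rfl

theorem IsNested.nestedLabel_injOn [Fintype L] (hG : IsBuildingSet G)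
    (hinj : Function.Injective ω) (hM : IsNested G M) (hcard : M.card = grade ℕ (⊤ : L)) :
    Set.InjOn (nestedLabel ω M) M := by
  obtain ⟨m, e⟩ := exists_isLinExt_of_partialOrder M
  have key : ∀ i < M.card, ∀ j < M.card, i < j →
      nestedLabel ω M (m i) ≠ nestedLabel ω M (m j) := by
    intro i hi j hj hij
    rw [← e.label_partialJoin hG hM ω hi, ← e.label_partialJoin hG hM ω hj]
    exact label_ne_label hinj (e.partialJoin_covBy hG hM hcard hi) (partialJoin_mono hij)
      (e.partialJoin_covBy hG hM hcard hj)
  intro x hx y hy hxy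
  obtain ⟨i, hi, rfl⟩ := e.surj x hx
  obtain ⟨j, hj, rfl⟩ := e.surj y hy
  rcases lt_trichotomy i j with h | h | h
  · exact absurd hxy (key i hi j hj h)
  · rw [h]
  · exact absurd hxy.symm (key j hj i hi h)

/-- The number of elements of `C` which are not above `x`. -/
noncomputable def flagIndex (C : Finset L) (x : L) : ℕ := by
  classical exact (C.filter (¬ x ≤ ·)).card

omit [BoundedOrder L] [GradeMinOrder ℕ L] in
theorem flagIndex_mono : Monotone (flagIndex C) := by
  classical
  intro x y hxy
  unfold flagIndex
  exact Finset.card_le_card fun c hc => by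
    rw [Finset.mem_filter] at hc ⊢
    exact ⟨hc.1, fun h => hc.2 (hxy.trans h)⟩

omit [BoundedOrder L] [GradeMinOrder ℕ L] in
theorem flagIndex_lt_iff (hC : IsChain (· ≤ ·) (C : Set L)) {x y : L} :
    flagIndex C x < flagIndex C y ↔ ∃ c ∈ C, x ≤ c ∧ ¬ y ≤ c := by
  classical
  constructor
  · intro h
    unfold flagIndex at h
    obtain ⟨c, hc, hcx⟩ := Finset.exists_mem_notMem_of_card_lt_card h
    rw [Finset.mem_filter] at hc hcx
    exact ⟨c, hc.1, by_contra fun h => hcx ⟨hc.1, h⟩, hc.2⟩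
  · rintro ⟨c, hc, hxc, hyc⟩
    unfold flagIndex
    refine Finset.card_lt_card ((Finset.ssubset_iff_of_subset fun d hd => ?_).mpr
      ⟨c, Finset.mem_filter.mpr ⟨hc, hyc⟩, fun h => (Finset.mem_filter.mp h).2 hxc⟩)
    rw [Finset.mem_filter] at hd ⊢
    refine ⟨hd.1, fun hyd => ?_⟩
    rcases hC.total hc hd.1 with h | h
    · exact hd.2 (hxc.trans h)
    · exact hyc (hyd.trans h)

/-- Climb from `x` to `y` through parents. All of them share one flag index, which keeps those below
`y` out of `T`; so no step is a descent, and injectivity makes each inequality strict. -/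
theorem IsFactorFlag.nestedLabel_lt [Fintype L] (hG : IsBuildingSet G)
    (hinj : Function.Injective ω) (hC : IsFactorFlag G T C) (hM : IsNested G M)
    (hcard : M.card = grade ℕ (⊤ : L)) (hdes : DescentsIn ω M T) {x y : L}
    (hx : x ∈ M) (hy : y ∈ M) (hxy : x < y) (hidx : flagIndex C x = flagIndex C y) :
    nestedLabel ω M x < nestedLabel ω M y := by
  revert hx hxy hidx
  induction x using WellFoundedGT.induction with
  | ind x ih =>
    intro hx hxy hidx
    have hxT : x ∉ T := by
      intro hxT
      obtain ⟨c, hc, hxc⟩ := hC.mem_factors x hxT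
      -- If `x` is a factor of `c ∈ C`, nothing in `G` strictly above `x` lies below `c`, so `c`
      -- separates `x` from `y`.
      refine hidx.not_lt ((flagIndex_lt_iff hC.isChain).mpr ⟨c, hc, le_of_mem_factors hxc, ?_⟩)
      exact fun hyc => hxy.ne' (eq_of_mem_factors_of_le hxc (hM.1 hy) hyc hxy.le)
    obtain ⟨p, hp, hpy⟩ := hM.exists_isLeast hG hx hy hxy
    have hlt : nestedLabel ω M x < nestedLabel ω M p :=
      lt_of_le_of_ne (hdes x hx hxT p hp)
        fun h => hp.1.2.ne (hM.nestedLabel_injOn hG hinj hcard hx hp.1.1 h)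
    rcases hpy.eq_or_lt with rfl | hpy
    · exact hlt
    · refine hlt.trans (ih p hp.1.2 hp.1.1 hpy (le_antisymm (flagIndex_mono hpy.le) ?_))
      rw [← hidx]
      exact flagIndex_mono hp.1.2.le

theorem IsFactorFlag.exists_isLinExt_isIncreasingOff [Fintype L] (hG : IsBuildingSet G)
    (hinj : Function.Injective ω) (hC : IsFactorFlag G T C) (hM : IsNested G M) (hTM : T ⊆ M)
    (hcard : M.card = grade ℕ (⊤ : L)) (hdes : DescentsIn ω M T) :
    ∃ m, IsLinExt M m ∧ IsIncreasingOff ω C (grade ℕ (⊤ : L)) (partialJoin m) := by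
  classical
  -- Flag index first makes the chain pass through `C`; label second makes it increase in between.
  let κ : L → ℕ ×ₗ ℕ := fun x => toLex (flagIndex C x, nestedLabel ω M x)
  obtain ⟨m, e, hκ⟩ := exists_isLinExt M κ
    (fun x hx y hy h => hM.nestedLabel_injOn hG hinj hcard hx hy
      (congrArg (fun p => (ofLex p).2) h))
    (by
      intro x hx y hy hxy
      rcases hxy.eq_or_lt with rfl | hlt
      · exact le_rfl
      refine Prod.Lex.toLex_le_toLex.mpr ?_
      rcases (flagIndex_mono (C := C) hxy).lt_or_eq with h | h
      · exact Or.inl h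
      · exact Or.inr ⟨h, (hC.nestedLabel_lt hG hinj hM hcard hdes hx hy hlt h).le⟩)
  have hinit : ∀ i j, i ≤ j → j < M.card → ∀ c ∈ C, m j ≤ c → m i ≤ c := by
    intro i j hij hj c hc hjc
    by_contra hic
    have h1 := (flagIndex_lt_iff hC.isChain).mpr ⟨c, hc, hjc, hic⟩
    rcases Prod.Lex.toLex_le_toLex.mp (hκ i (by omega) j hj hij) with h2 | h2
    · exact h1.not_gt h2
    · exact h1.ne' h2.1
  have hthrough : ∀ c ∈ C, ∃ r ≤ M.card, partialJoin m r = c ∧ ∀ i < M.card, m i ≤ c → i < r := by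
    intro c hc
    -- The elements below `c` form an initial segment of the enumeration; `r` is its length.
    have hex : ∃ r, r = M.card ∨ (r < M.card ∧ ¬ m r ≤ c) := ⟨_, Or.inl rfl⟩
    have hr := Nat.find_spec hex
    have hmin : ∀ i < Nat.find hex, m i ≤ c := by
      intro i hi
      have h1 := Nat.find_min hex hi
      have h2 : Nat.find hex ≤ M.card := by rcases hr with h | h <;> omega
      by_contra h3
      exact h1 (Or.inr ⟨by omega, h3⟩)
    have hlt : ∀ i < M.card, m i ≤ c → i < Nat.find hex := by
      intro i hi hic
      by_contra hcon
      rcases hr with h | h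
      · omega
      · exact h.2 (hinit _ i (by omega) hi c hc hic)
    refine ⟨Nat.find hex, by rcases hr with h | h <;> omega, le_antisymm ?_ ?_, hlt⟩
    · exact Finset.sup_le fun i hi => hmin i (Finset.mem_range.mp hi)
    · obtain ⟨U, hU, hUc⟩ := hC.eq_sup c hc
      conv_lhs => rw [← hUc]
      refine Finset.sup_le fun u hu => ?_
      obtain ⟨i, hi, rfl⟩ := e.surj u (hTM (hU hu))
      exact le_partialJoin (hlt i hi ((Finset.le_sup (f := id) hu).trans hUc.le))
  refine ⟨m, e, rfl, hcard ▸ e.partialJoin_card hG hM hcard,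
    fun i hi => e.partialJoin_covBy hG hM hcard (by omega), fun c hc => ?_, fun i hi hiC => ?_⟩
  · obtain ⟨r, hr, hrc, -⟩ := hthrough c hc
    exact ⟨r, hcard ▸ hr, hrc⟩
  · rw [e.label_partialJoin hG hM ω (by omega), e.label_partialJoin hG hM ω (by omega)]
    rcases Prod.Lex.toLex_le_toLex.mp (hκ i (by omega) (i + 1) (by omega) (by omega)) with h | h
    -- A jump of the flag index between `m i` and `m (i + 1)` is caused by some `c ∈ C`, and then
    -- the partial join at `i + 1` is `c`, contrary to `hiC`.
    · exfalso
      obtain ⟨c, hc, hic, hic'⟩ := (flagIndex_lt_iff hC.isChain).mp h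
      obtain ⟨r, hr, rfl, hlt⟩ := hthrough c hc
      have h1 := hlt i (by omega) hic
      have h2 : ¬ i + 1 < r := fun h => hic' (le_partialJoin h)
      exact hiC (by rwa [show i + 1 = r by omega])
    · exact h.2

theorem IsFactorFlag.eq_of_descentsIn [Fintype L] (hG : IsBuildingSet G)
    (hinj : Function.Injective ω) (hadm : IsAdmissible ω) (hC : IsFactorFlag G T C)
    {M M' : Finset L} (hM : IsNested G M) (hM' : IsNested G M') (hTM : T ⊆ M) (hTM' : T ⊆ M')
    (hcard : M.card = grade ℕ (⊤ : L)) (hcard' : M'.card = grade ℕ (⊤ : L))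
    (hdes : DescentsIn ω M T) (hdes' : DescentsIn ω M' T) : M = M' := by
  obtain ⟨m, e, hF⟩ := hC.exists_isLinExt_isIncreasingOff hG hinj hM hTM hcard hdes
  obtain ⟨m', e', hF'⟩ := hC.exists_isLinExt_isIncreasingOff hG hinj hM' hTM' hcard' hdes'
  ext g
  rw [e.mem_iff_mem_factors hG hM, e'.mem_iff_mem_factors hG hM', hcard, hcard']
  refine exists_congr fun r => and_congr_right fun hr => ?_
  rw [hadm.eq_of_isIncreasingOff hC.isChain hC.bot_mem hC.top_mem hF hF' (r := r + 1) hr]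

end Flags

/-! ### Facets of the nested set complex -/

section Complex

variable {L : Type*} [Lattice L] [BoundedOrder L] {G S T : Finset L}
  {ω : {I : L // SupIrred I} → ℕ+}

theorem mem_faces_nestedSetComplex [Fintype L] (htop : ⊤ ∈ G) :
    S ∈ (nestedSetComplex G).faces ↔ IsNested G S ∧ ⊤ ∉ S := by
  classical
  have hmax : ∀ g, Maximal (· ∈ G) g ↔ g = ⊤ := fun g =>
    ⟨fun h => h.eq_of_le htop le_top, fun h => h ▸ ⟨htop, fun _ _ _ => le_top⟩⟩
  unfold nestedSetComplex
  simp only [Finset.mem_filter, Finset.mem_univ, true_and, hmax]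
  exact and_congr_right fun _ => ⟨fun h hS => h _ hS rfl, fun h g hg hgt => h (hgt ▸ hg)⟩

theorem nestedLabel_insert_top [DecidableEq L] (g : L) :
    nestedLabel ω (insert ⊤ S) g = nestedLabel ω S g := by
  have : lowerJoin (insert ⊤ S) g = lowerJoin S g := by
    unfold lowerJoin
    congr 1
    ext x
    simp only [Finset.mem_filter, Finset.mem_insert]
    exact ⟨fun h => ⟨h.1.resolve_left fun hx => not_top_lt (hx ▸ h.2), h.2⟩,
      fun h => ⟨Or.inr h.1, h.2⟩⟩
  rw [nestedLabel, nestedLabel, this]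

theorem isParent_iff [DecidableEq L] {g p : L} :
    IsParent S g p ↔ IsLeast {x | x ∈ insert ⊤ S ∧ g < x} p := by
  unfold IsParent
  simp only [Finset.mem_insert, or_comm]

/-- Adjoining `⊤` to both sets exempts it from the condition; all other elements keep their labels
and parents. -/
theorem descentsIn_insert_top_iff [DecidableEq L] :
    DescentsIn ω (insert ⊤ S) (insert ⊤ T) ↔ ∀ g, IsDescent ω S g → g ∈ T := by
  simp only [DescentsIn, nestedLabel_insert_top, ← isParent_iff]
  constructor
  · rintro h g ⟨hg, p, hp, hlt⟩
    by_contra hgT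
    refine hlt.not_ge (h g (Finset.mem_insert_of_mem hg) ?_ p hp)
    rw [Finset.mem_insert, not_or]
    exact ⟨fun hgt => not_top_lt (hgt ▸ hp.1.2), hgT⟩
  · intro h g hg hgT p hp
    rw [Finset.mem_insert, not_or] at hgT
    by_contra hcon
    exact hgT.2 (h g ⟨(Finset.mem_insert.mp hg).resolve_left hgT.1, p, hp, not_le.mp hcon⟩)

variable [Fintype L] [GradeMinOrder ℕ L]

theorem exists_face_superset [DecidableEq L] (hG : IsBuildingSet G) (htop : ⊤ ∈ G)
    (hadm : IsAdmissible ω) (hT : T ∈ (nestedSetComplex G).faces) :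
    ∃ S ∈ (nestedSetComplex G).faces, T ⊆ S ∧ (insert ⊤ S).card = grade ℕ (⊤ : L) ∧
      ∀ g, IsDescent ω S g → g ∈ T := by
  rw [mem_faces_nestedSetComplex htop] at hT
  have hT' := hT.1.insert_top htop
  have htopT := Finset.mem_insert_self ⊤ T
  obtain ⟨C, hC⟩ := hT'.exists_isFactorFlag hG htopT
  obtain ⟨M, hM, hTM, hcard, hdes⟩ := hC.exists_isNested hG hadm
  have hins : insert ⊤ (M.erase ⊤) = M := Finset.insert_erase (hTM htopT)
  refine ⟨M.erase ⊤, (mem_faces_nestedSetComplex htop).mpr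
    ⟨hM.subset (Finset.erase_subset _ _), Finset.notMem_erase _ _⟩, ?_, by rw [hins, hcard], ?_⟩
  · exact fun x hx => Finset.mem_erase.mpr
      ⟨fun h => hT.2 (h ▸ hx), hTM (Finset.mem_insert_of_mem hx)⟩
  · rw [← descentsIn_insert_top_iff, hins]
    exact hdes

theorem card_insert_top_le [DecidableEq L] (hG : IsBuildingSet G) (htop : ⊤ ∈ G)
    (hS : S ∈ (nestedSetComplex G).faces) : (insert ⊤ S).card ≤ grade ℕ (⊤ : L) := by
  rw [mem_faces_nestedSetComplex htop] at hS
  obtain ⟨m, e⟩ := exists_isLinExt_of_partialOrder (insert ⊤ S)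
  exact e.card_le_grade_top hG (hS.1.insert_top htop)

/-- Purity: every face extends to one of the largest possible size. -/
theorem mem_facets_nestedSetComplex [DecidableEq L] (hG : IsBuildingSet G) (htop : ⊤ ∈ G)
    (hadm : IsAdmissible ω) : S ∈ (nestedSetComplex G).facets ↔
      S ∈ (nestedSetComplex G).faces ∧ (insert ⊤ S).card = grade ℕ (⊤ : L) := by
  rw [FinSimplicialComplex.mem_facets]
  constructor
  · intro hS
    obtain ⟨S', hS', hle, hcard, -⟩ := exists_face_superset hG htop hadm hS.prop
    rw [hS.eq_of_le hS' hle]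
    exact ⟨hS', hcard⟩
  · rintro ⟨hS, hcard⟩
    refine ⟨hS, fun S' hS' hle => ?_⟩
    have h1 := card_insert_top_le hG htop hS'
    rw [← hcard, Finset.card_insert_of_notMem ((mem_faces_nestedSetComplex htop).mp hS').2,
      Finset.card_insert_of_notMem ((mem_faces_nestedSetComplex htop).mp hS).2] at h1
    exact (Finset.eq_of_subset_of_card_le hle (by omega)).ge

theorem card_of_mem_facets_nestedSetComplex (hG : IsBuildingSet G) (htop : ⊤ ∈ G)
    (hadm : IsAdmissible ω) (hS : S ∈ (nestedSetComplex G).facets) :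
    S.card = (nestedSetComplex G).size := by
  classical
  have hS' := (mem_facets_nestedSetComplex hG htop hadm).mp hS
  refine le_antisymm (Finset.le_sup (f := Finset.card) hS'.1) (Finset.sup_le fun T hT => ?_)
  have h1 := card_insert_top_le hG htop hT
  rw [← hS'.2, Finset.card_insert_of_notMem ((mem_faces_nestedSetComplex htop).mp hT).2,
    Finset.card_insert_of_notMem ((mem_faces_nestedSetComplex htop).mp hS'.1).2] at h1
  omega

theorem existsUnique_facet (hG : IsBuildingSet G) (htop : ⊤ ∈ G) (hinj : Function.Injective ω)
    (hadm : IsAdmissible ω) (hT : T ∈ (nestedSetComplex G).faces) :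
    ∃! S, S ∈ (nestedSetComplex G).facets ∧ (∀ g, IsDescent ω S g → g ∈ T) ∧ T ⊆ S := by
  classical
  obtain ⟨S, hS, hTS, hcard, hdes⟩ := exists_face_superset hG htop hadm hT
  refine ⟨S, ⟨(mem_facets_nestedSetComplex hG htop hadm).mpr ⟨hS, hcard⟩, hdes, hTS⟩, ?_⟩
  rintro S' ⟨hS', hdes', hTS'⟩
  obtain ⟨hS', hcard'⟩ := (mem_facets_nestedSetComplex hG htop hadm).mp hS'
  rw [mem_faces_nestedSetComplex htop] at hS hS' hT
  rw [← descentsIn_insert_top_iff] at hdes hdes'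
  -- The conditions on `S` and `S'` do not mention a flag, so any one flag for `T` serves to compare
  -- them.
  obtain ⟨C, hC⟩ := (hT.1.insert_top htop).exists_isFactorFlag hG (Finset.mem_insert_self ⊤ T)
  have heq := hC.eq_of_descentsIn hG hinj hadm (hS'.1.insert_top htop) (hS.1.insert_top htop)
    (Finset.insert_subset_insert ⊤ hTS') (Finset.insert_subset_insert ⊤ hTS) hcard' hcard hdes' hdes
  rw [← Finset.erase_insert hS'.2, heq, Finset.erase_insert hS.2]

end Complex

end BuiltLattice

theorem mainTheorem5 {L : Type*} [Lattice L] [BoundedOrder L] [Fintype L]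
    (hgraded : BuiltLattice.IsGraded L)
    (G : Finset L) (hG : BuiltLattice.IsBuildingSet G) (hirr : ⊤ ∈ G)
    (ω : {I : L // SupIrred I} → ℕ+) (hinj : Function.Injective ω)
    (hadm : BuiltLattice.IsAdmissible ω) :
    BuiltLattice.descentHPolynomial G ω = (BuiltLattice.nestedSetComplex G).hPolynomial := by
  classical
  obtain ⟨_⟩ := hgraded
  -- The lower end of the interval of a facet is its set of descents.
  rw [FinSimplicialComplex.hPolynomial_eq_sum_of_partition (BuiltLattice.nestedSetComplex G)
    (fun S hS => BuiltLattice.card_of_mem_facets_nestedSetComplex hG hirr hadm hS)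
    (fun S => S.filter (fun g => BuiltLattice.IsDescent ω S g))
    (fun S _ => Finset.filter_subset _ S) ?_]
  · unfold BuiltLattice.descentHPolynomial BuiltLattice.des
    refine Finset.sum_congr rfl fun S _ => ?_
    congr
  · intro T hT
    obtain ⟨S, ⟨hS, hdes, hTS⟩, huniq⟩ := BuiltLattice.existsUnique_facet hG hirr hinj hadm hT
    refine ⟨S, ⟨hS, fun g hg => hdes g (Finset.mem_filter.mp hg).2, hTS⟩, ?_⟩
    rintro S' ⟨hS', hdes', hTS'⟩
    exact huniq S' ⟨hS', fun g hg => hdes' (Finset.mem_filter.mpr ⟨hg.1, hg⟩), hTS'⟩
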